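/- Let $M$ be a smooth manifold, $j\colon L\hookrightarrow M$ an embedded submanifold, and $\Psi\in\Omega^d(M,TM)$ a smooth $TM$-valued $d$-form with $d\le\dim L$. Let $\pi\colon NL=TM|_L/TL\to L$ be the normal bundle and let $\tau\colon NL\to U\subset M$ be a tubular neighbourhood, i.e. a diffeomorphism onto an open neighbourhood $U$ of $L$ which restricts to $j$ on the zero section $\mathbf 0\colon L\to NL$. For a local diffeomorphism $f$ put $(f^*K)_p(v_1,\dots,v_d)=(T_pf)^{-1}K_{f(p)}(T_pf\,v_1,\dots,T_pf\,v_d)$, and write again $\Psi$ for the form $\tau^*\Psi\in\Omega^d(NL,TNL)$. An embedded submanifold $S$ of $NL$ with $\dim S\ge d$ is called a $\Psi$-submanifold if $\Psi_p(v_1,\dots,v_d)\in T_pS$ for all $p\in S$ and $v_1,\dots,v_d\in T_pS$. A smooth section $s\colon L\to NL$ is called a $\Psi$-section if its image $s(L)$ is a $\Psi$-submanifold of $NL$. For a smooth section $s$ let $\iota_L(s)$ be the vertical vector field on $NL$ whose value at $e$ is $\frac{d}{dt}\big|_{t=0}(e+t\,s(\pi(e)))$, and let $\exp\iota_L(s)$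 be the time-one map of its flow. For $K\in\Omega^d(NL,TNL)$ let $P_L(K)\in\Omega^d(L,NL)$ be the restriction of $K$ to the zero section followed by the projection $TNL|_L=TL\oplus NL\to NL$. Set $$F_\Psi(s)=P_L\bigl((\exp\iota_L(s))^*\Psi\bigr)=P_L\bigl((\exp\iota_L(-s))_*\Psi\bigr)\in\Omega^d(L,NL),$$ where $(\exp\iota_L(-s))_*$ is the push-forward, i.e. the pull-back along the inverse diffeomorphism $\exp\iota_L(s)$. Then for every smooth section $s\colon L\to NL$: $s$ is a $\Psi$-section if and only if $F_\Psi(s)=0$ in $\Omega^d(L,NL)$. -/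

import Mathlib

open Bundle Set Topology
open scoped Manifold ContDiff

noncomputable section

/-! ### Tangent-bundle-valued forms -/

section Forms

variable {EX : Type*} [NormedAddCommGroup EX] [NormedSpace ℝ EX]
  {HX : Type*} [TopologicalSpace HX] (I : ModelWithCorners ℝ EX HX)
  {X : Type*} [TopologicalSpace X] [ChartedSpace HX X]
  {EY : Type*} [NormedAddCommGroup EY] [NormedSpace ℝ EY]
  {HY : Type*} [TopologicalSpace HY] (J : ModelWithCorners ℝ EY HY)
  {Y : Type*} [TopologicalSpace Y] [ChartedSpace HY Y]

/-- A (not necessarily smooth) `TX`-valued differential form of degree `d` on `X`: an alternating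
map `(T_p X)^d → T_p X` for every point `p`. -/
abbrev TangentForm (X : Type*) [TopologicalSpace X] [ChartedSpace HX X] (d : ℕ) :=
  (p : X) → (TangentSpace I p) [⋀^Fin d]→L[ℝ] (TangentSpace I p)

/-- Smoothness of a `TX`-valued form: around every point `p₀`, the form read in the local
trivialization of `TX` at `p₀` is a smooth function with values in the fixed finite-dimensional
space of alternating maps of the model space. Elements of `Ω^d(X, TX)` are the
`Ψ : TangentForm I X d` with `IsSmoothForm I Ψ`. -/
def IsSmoothForm [IsManifold I ∞ X] {d : ℕ} (Ψ : TangentForm I X d) : Prop :=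
  ∀ p₀ : X, ContMDiffAt I 𝓘(ℝ, EX [⋀^Fin d]→L[ℝ] EX) ∞
    (fun p => ContinuousAlternatingMap.inCoordinates (E₁ := fun q : X => TangentSpace I q)
      (E₂ := fun q : X => TangentSpace I q) EX EX p₀ p p₀ p (Ψ p)) p₀

/-- Pull-back of a `TY`-valued form along a local diffeomorphism `f : X → Y`:
`(f^*Ψ)_p (v₁, …, v_d) = (T_p f)⁻¹ Ψ_{f p} (T_p f v₁, …, T_p f v_d)`. -/
def pullbackForm {d : ℕ} (f : X → Y) (Ψ : TangentForm J Y d) : TangentForm I X d := fun p =>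
  (ContinuousLinearMap.inverse (mfderiv I J f p)).compContinuousAlternatingMap
    ((Ψ (f p)).compContinuousLinearMap (mfderiv I J f p))

/-! ### Submanifolds -/

/-- Smooth embeddings of manifolds: smooth topological embeddings with injective differentials. -/
structure IsEmbeddingOfManifolds (f : X → Y) : Prop where
  contMDiff : ContMDiff I J ∞ f
  isEmbedding : IsEmbedding f
  injective_mfderiv : ∀ p, Function.Injective (mfderiv I J f p)

/-- `S ⊆ X` is an embedded submanifold of dimension `l`: the subspace `S` carries the structure of
a smooth `l`-dimensional manifold for which the inclusion `S → X` is a smooth embedding. -/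
def IsEmbeddedSubmanifold (S : Set X) (l : ℕ) : Prop :=
  ∃ _ : ChartedSpace (EuclideanSpace ℝ (Fin l)) S,
    IsManifold (𝓡 l) ∞ S ∧ IsEmbeddingOfManifolds (𝓡 l) I (Subtype.val : S → X)

/-- The tangent vectors at `p` to a subset `S` of `X`: the velocities at time `0` of the curves in
`X` which are smooth at `0`, pass through `p` at time `0` and stay in `S` near time `0`. If `S` is
an embedded submanifold and `p ∈ S`, then this is the tangent space `T_p S ⊆ T_p X`. -/
def tangentVectors (S : Set X) (p : X) : Set (TangentSpace I p) :=
  {v | ∃ γ : ℝ → X, ContMDiffAt 𝓘(ℝ, ℝ) I ∞ γ 0 ∧ (∀ᶠ t in 𝓝 (0 : ℝ), γ t ∈ S) ∧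
    (⟨γ 0, mfderiv 𝓘(ℝ, ℝ) I γ 0 (1 : ℝ)⟩ : TangentBundle I X) = ⟨p, v⟩}

/-- `S` is a `Ψ`-submanifold of `X`: it is an embedded submanifold, of dimension at least the
degree of `Ψ`, and the restriction of `Ψ` to `S` takes values in the tangent bundle of `S`. -/
def IsPsiSubmanifold {d : ℕ} (Ψ : TangentForm I X d) (S : Set X) : Prop :=
  (∃ l : ℕ, d ≤ l ∧ IsEmbeddedSubmanifold I S l) ∧
  ∀ p ∈ S, ∀ v : Fin d → TangentSpace I p,
    (∀ i, v i ∈ tangentVectors I S p) → Ψ p v ∈ tangentVectors I S p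

/-- The time-one map `exp V = ψ₁` of the flow `ψ` of a complete vector field `V`: the point `p` is
sent to `γ 1`, where `γ` is the integral curve of `V` defined on all of `ℝ` with `γ 0 = p`.
(A point through which no such curve exists is left fixed; this does not occur for complete `V`.) -/
def expField (V : (p : X) → TangentSpace I p) : X → X := fun p =>
  open Classical in
  if h : ∃ γ : ℝ → X, γ 0 = p ∧ IsMIntegralCurve (I := I) γ V then h.choose 1 else p

end Forms

/-! ### Vector bundles: vertical lift and normal projection along the zero section -/

section VectorBundles

variable {EL : Type*} [NormedAddCommGroup EL] [NormedSpace ℝ EL]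
  {HL : Type*} [TopologicalSpace HL] (I : ModelWithCorners ℝ EL HL)
  {L : Type*} [TopologicalSpace L] [ChartedSpace HL L]
  (F : Type*) [NormedAddCommGroup F] [NormedSpace ℝ F]
  (E : L → Type*) [∀ x, AddCommGroup (E x)] [∀ x, Module ℝ (E x)] [∀ x, TopologicalSpace (E x)]
  [TopologicalSpace (TotalSpace F E)] [FiberBundle F E]

/-- Canonical vertical lift of `n ∈ E_{π e}` to `T_e E`: the velocity at `t = 0` of `t ↦ e + t n`. -/
def verticalLift (e : TotalSpace F E) (n : E e.proj) : TangentSpace (I.prod 𝓘(ℝ, F)) e :=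
  mfderiv 𝓘(ℝ, ℝ) (I.prod 𝓘(ℝ, F))
    (fun t : ℝ => (⟨e.proj, e.snd + t • n⟩ : TotalSpace F E)) 0 (1 : ℝ)

/-- `ι_L(s)`: the vertical vector field on the total space of `E` defined by a section `s`. -/
def iotaField (s : (x : L) → E x) (e : TotalSpace F E) : TangentSpace (I.prod 𝓘(ℝ, F)) e :=
  verticalLift I F E e (s e.proj)

variable [VectorBundle ℝ F E]

/-- The projection `T_{0_x} E = T_x L ⊕ E_x → E_x` given by the canonical splitting along the zero
section: the fibre component of a tangent vector in the local trivialization of `E` at `x`.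
The lemmas `normalProj_zeroSection` and `normalProj_verticalLift` show that this is the projection
with kernel `T_x L` (embedded by the zero section) which inverts the vertical lift. -/
def normalProj (x : L) : TangentSpace (I.prod 𝓘(ℝ, F)) (zeroSection F E x) →L[ℝ] E x :=
  ((trivializationAt F E x).symmL ℝ x).comp
    (mfderiv (I.prod 𝓘(ℝ, F)) 𝓘(ℝ, F) (fun e : TotalSpace F E => (trivializationAt F E x e).2)
      (zeroSection F E x))

section

variable [ContMDiffVectorBundle ∞ F E I]

theorem mdifferentiableAt_trivialization_snd (x : L) (e : TotalSpace F E) (he : e.proj = x) :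
    MDifferentiableAt (I.prod 𝓘(ℝ, F)) 𝓘(ℝ, F)
      (fun e : TotalSpace F E => (trivializationAt F E x e).2) e := by
  have h1 := (trivializationAt F E x).contMDiffOn (n := ∞) (IB := I)
  have h2 : e ∈ (trivializationAt F E x).source := by
    rw [Trivialization.mem_source, he]; exact mem_baseSet_trivializationAt F E x
  have h3 := (h1.contMDiffAt ((trivializationAt F E x).open_source.mem_nhds h2)).snd
  exact h3.mdifferentiableAt (by simp)

theorem normalProj_zeroSection (x : L) (v : TangentSpace I x) :
    normalProj I F E x (mfderiv I (I.prod 𝓘(ℝ, F)) (zeroSection F E) x v) = 0 := by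
  have hz : MDifferentiableAt I (I.prod 𝓘(ℝ, F)) (zeroSection F E) x :=
    ((contMDiff_zeroSection ℝ E (n := ∞) (IB := I)) x).mdifferentiableAt (by simp)
  have hg := mdifferentiableAt_trivialization_snd I F E x (zeroSection F E x) rfl
  have hc := mfderiv_comp x hg hz
  have h0 : ((fun e : TotalSpace F E => (trivializationAt F E x e).2) ∘ zeroSection F E)
      =ᶠ[𝓝 x] fun _ => (0 : F) := by
    filter_upwards [(trivializationAt F E x).open_baseSet.mem_nhds
      (mem_baseSet_trivializationAt F E x)] with y hy
    have := (trivializationAt F E x).zeroSection ℝ hy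
    simp [Function.comp, this]
  have h2 : mfderiv I 𝓘(ℝ, F)
      ((fun e : TotalSpace F E => (trivializationAt F E x e).2) ∘ zeroSection F E) x = 0 := by
    rw [h0.mfderiv_eq]; exact mfderiv_const
  rw [h2] at hc
  have h3 := congrArg (fun A => A v) hc
  have h4 : mfderiv (I.prod 𝓘(ℝ, F)) 𝓘(ℝ, F)
      (fun e : TotalSpace F E => (trivializationAt F E x e).2) (zeroSection F E x)
      (mfderiv I (I.prod 𝓘(ℝ, F)) (zeroSection F E) x v) = 0 := h3.symm
  show (trivializationAt F E x).symmL ℝ x _ = 0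
  exact (congrArg _ h4).trans (map_zero _)

theorem contMDiff_verticalCurve (e : TotalSpace F E) (n : E e.proj) :
    ContMDiff 𝓘(ℝ, ℝ) (I.prod 𝓘(ℝ, F)) ∞
      (fun t : ℝ => (⟨e.proj, e.snd + t • n⟩ : TotalSpace F E)) := by
  have hb := mem_baseSet_trivializationAt F E e.proj
  refine (Trivialization.contMDiff_iff (e := trivializationAt F E e.proj)
    (fun t => by rw [Trivialization.mem_source]; exact hb)).2 ?_
  refine ⟨contMDiff_const, ?_⟩
  have h : (fun t : ℝ => (trivializationAt F E e.proj ⟨e.proj, e.snd + t • n⟩).2) =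
      fun t : ℝ => (trivializationAt F E e.proj).continuousLinearMapAt ℝ e.proj e.snd +
        t • (trivializationAt F E e.proj).continuousLinearMapAt ℝ e.proj n := by
    funext t
    rw [← map_smul, ← map_add, Trivialization.continuousLinearMapAt_apply,
      Trivialization.linearMapAt_apply, if_pos hb]
  rw [h]
  exact (contDiff_const.add (contDiff_id.smul contDiff_const)).contMDiff

theorem normalProj_verticalLift (x : L) (n : E x) :
    normalProj I F E x (verticalLift I F E (zeroSection F E x) n) = n := by
  have hb := mem_baseSet_trivializationAt F E x
  have hcurve : (⟨x, (0 : E x) + (0 : ℝ) • n⟩ : TotalSpace F E) = ⟨x, 0⟩ := by simp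
  have hz := (((contMDiff_verticalCurve I F E (⟨x, 0⟩ : TotalSpace F E) n) 0).mdifferentiableAt
    (by simp)).hasMFDerivAt
  have aux : ∀ p : TotalSpace F E, p = ⟨x, 0⟩ →
      HasMFDerivAt (I.prod 𝓘(ℝ, F)) 𝓘(ℝ, F)
        (fun e : TotalSpace F E => (trivializationAt F E x e).2) p
        (mfderiv (I.prod 𝓘(ℝ, F)) 𝓘(ℝ, F)
          (fun e : TotalSpace F E => (trivializationAt F E x e).2) (⟨x, 0⟩ : TotalSpace F E) :
          (EL × F) →L[ℝ] F) := by
    rintro p rfl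
    exact (mdifferentiableAt_trivialization_snd I F E x (⟨x, 0⟩ : TotalSpace F E)
      rfl).hasMFDerivAt
  have hc := (HasMFDerivAt.comp (0 : ℝ) (aux _ hcurve) hz).mfderiv
  have h : ((fun e : TotalSpace F E => (trivializationAt F E x e).2) ∘
      fun t : ℝ => (⟨x, (0 : E x) + t • n⟩ : TotalSpace F E)) =
      fun t : ℝ => t • (trivializationAt F E x).continuousLinearMapAt ℝ x n := by
    funext t
    rw [← map_smul, Trivialization.continuousLinearMapAt_apply,
      Trivialization.linearMapAt_apply, if_pos hb]
    simp
  rw [h, mfderiv_eq_fderiv] at hc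
  have hd : fderiv ℝ (fun t : ℝ => t • (trivializationAt F E x).continuousLinearMapAt ℝ x n) 0
      (1 : ℝ) = (trivializationAt F E x).continuousLinearMapAt ℝ x n := by
    have := ((hasDerivAt_id (0 : ℝ)).smul_const
      ((trivializationAt F E x).continuousLinearMapAt ℝ x n)).hasFDerivAt.fderiv
    simp only [id] at this
    rw [this]; simp
  have h3 := (congrArg (fun A => A (1 : ℝ)) hc).symm.trans hd
  show (trivializationAt F E x).symmL ℝ x _ = n
  refine (congrArg _ h3).trans ?_
  exact Trivialization.symmL_continuousLinearMapAt _ hb n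

/-- `ι_L(s)` is complete: through `e` passes the integral curve `t ↦ e + t s(π e)`. -/
theorem isMIntegralCurve_iotaField (s : (x : L) → E x) (e : TotalSpace F E) :
    IsMIntegralCurve (I := I.prod 𝓘(ℝ, F))
      (fun t : ℝ => (⟨e.proj, e.snd + t • s e.proj⟩ : TotalSpace F E)) (iotaField I F E s) := by
  intro t
  have h1 := (((contMDiff_verticalCurve I F E (⟨e.proj, e.snd + t • s e.proj⟩ : TotalSpace F E)
    (s e.proj)) 0).mdifferentiableAt (by simp)).hasMFDerivAt
  have h2 : HasMFDerivAt 𝓘(ℝ, ℝ) 𝓘(ℝ, ℝ) (fun r : ℝ => r + -t) t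
      (ContinuousLinearMap.id ℝ ℝ) := ((hasFDerivAt_id t).add_const (-t)).hasMFDerivAt
  have h0 : (fun r : ℝ => r + -t) t = 0 := add_neg_cancel t
  rw [← h0] at h1
  have h3 := HasMFDerivAt.comp t h1 h2
  have h4 : ((fun r : ℝ => (⟨e.proj, e.snd + t • s e.proj + r • s e.proj⟩ : TotalSpace F E)) ∘
      fun r : ℝ => r + -t) = fun r : ℝ => (⟨e.proj, e.snd + r • s e.proj⟩ : TotalSpace F E) := by
    funext r
    simp only [Function.comp, add_assoc, ← add_smul]
    rw [add_comm r (-t), add_neg_cancel_left]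
  rw [h4] at h3
  refine h3.congr_mfderiv ?_
  rw [h0]
  ext
  exact (one_smul ℝ _).symm

end

/-- `P_L K ∈ Ω^d(L, E)`: restrict the `TE`-valued form `K` to the zero section `L` and project to
the fibres of `E`. -/
def restrictProj {d : ℕ} (K : TangentForm (I.prod 𝓘(ℝ, F)) (TotalSpace F E) d) (x : L) :
    (TangentSpace I x) [⋀^Fin d]→L[ℝ] (E x) :=
  (normalProj I F E x).compContinuousAlternatingMap
    ((K (zeroSection F E x)).compContinuousLinearMap
      (mfderiv I (I.prod 𝓘(ℝ, F)) (zeroSection F E) x))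

/-- `F_Ψ(s) = P_L((exp ι_L(s))^* Ψ) = P_L((exp ι_L(-s))_* Ψ)`, a form on `L` with values in `E`. -/
def deformationForm {d : ℕ} (Ψ : TangentForm (I.prod 𝓘(ℝ, F)) (TotalSpace F E) d)
    (s : (x : L) → E x) (x : L) : (TangentSpace I x) [⋀^Fin d]→L[ℝ] (E x) :=
  restrictProj I F E
    (pullbackForm (I.prod 𝓘(ℝ, F)) (I.prod 𝓘(ℝ, F))
      (expField (I.prod 𝓘(ℝ, F)) (iotaField I F E s)) Ψ) x

/-- `s` is a `Ψ`-section: its image is a `Ψ`-submanifold of the total space. -/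
def IsPsiSection {d : ℕ} (Ψ : TangentForm (I.prod 𝓘(ℝ, F)) (TotalSpace F E) d)
    (s : (x : L) → E x) : Prop :=
  IsPsiSubmanifold (I.prod 𝓘(ℝ, F)) Ψ (range fun x => (⟨x, s x⟩ : TotalSpace F E))

end VectorBundles

section NormalBundle

variable {EL : Type*} [NormedAddCommGroup EL] [NormedSpace ℝ EL]
  {HL : Type*} [TopologicalSpace HL] (I : ModelWithCorners ℝ EL HL)
  {L : Type*} [TopologicalSpace L] [ChartedSpace HL L]
  {EM : Type*} [NormedAddCommGroup EM] [NormedSpace ℝ EM]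
  {HM : Type*} [TopologicalSpace HM] (J : ModelWithCorners ℝ EM HM)
  {M : Type*} [TopologicalSpace M] [ChartedSpace HM M]

/-- The fibre `N_x L = T_{j x} M / T_x L` of the normal bundle of `j : L → M`. -/
abbrev NormalFiber (j : L → M) (x : L) : Type _ :=
  TangentSpace J (j x) ⧸
    LinearMap.range (mfderiv I J j x : TangentSpace I x →ₗ[ℝ] TangentSpace J (j x))

/-- The canonical projection `pr : T_{j x} M → N_x L`. -/
def normalQuot (j : L → M) (x : L) : TangentSpace J (j x) →L[ℝ] NormalFiber I J j x :=
  Submodule.mkQL _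

/-- The vector bundle structure on `NL = ⋃ₓ N_x L` is the quotient one: the canonical projection
`pr : TM|_L → NL` is a smooth map of vector bundles over `L`. As `pr` is surjective, this determines
the smooth vector bundle structure of `NL`. -/
def IsNormalBundle [IsManifold J ∞ M] (j : L → M) (F : Type*) [NormedAddCommGroup F]
    [NormedSpace ℝ F] [TopologicalSpace (TotalSpace F (NormalFiber I J j))]
    [FiberBundle F (NormalFiber I J j)] [VectorBundle ℝ F (NormalFiber I J j)] : Prop :=
  ∀ x₀ : L, ContMDiffAt I 𝓘(ℝ, EM →L[ℝ] F) ∞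
    (fun x => ContinuousLinearMap.inCoordinates EM (fun q : M => TangentSpace J q) F
      (NormalFiber I J j) (j x₀) (j x) x₀ x (normalQuot I J j x)) x₀

/-- A tubular neighbourhood of `j : L → M`: a diffeomorphism `τ` of the total space of a vector
bundle over `L` (the normal bundle) onto an open subset of `M`, extending `j` from the zero
section. -/
structure IsTubularNeighborhood (j : L → M) (F : Type*) [NormedAddCommGroup F]
    [NormedSpace ℝ F] (E : L → Type*) [∀ x, AddCommGroup (E x)] [∀ x, Module ℝ (E x)]
    [∀ x, TopologicalSpace (E x)] [TopologicalSpace (TotalSpace F E)] [FiberBundle F E]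
    (τ : TotalSpace F E → M) : Prop where
  isLocalDiffeomorph : IsLocalDiffeomorph (I.prod 𝓘(ℝ, F)) J ∞ τ
  injective : Function.Injective τ
  zeroSection : ∀ x, τ (zeroSection F E x) = j x

end NormalBundle

end

/-!
The statement holds for every smooth vector bundle `E → L` and every `TE`-valued form `Ψ` on its
total space (`isPsiSection_iff_deformationForm_eq_zero`); the theorem is the case of the normal
bundle and of the form pulled back by the tubular neighbourhood.

The vector field `ι_L(s)` is vertical and constant along the fibres, so its integral curves are
`t ↦ e + t s(π e)` and `exp ι_L(s)` is the fibrewise translation `φ : e ↦ e + s(π e)`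
(`expField_iotaField`). It is a diffeomorphism which carries the zero section to `s`, whence
`Tφ ∘ T0 = Ts`, and
`F_Ψ(s)_x (v₁, …, v_d) = P_L ((Tφ)⁻¹ Ψ (Ts v₁, …, Ts v_d))`.
The kernel of `P_L` at `0_x` is the image of `T_x 0` (`normalProj_eq_zero_iff`), and `Tφ` carries it
to the image of `T_x s`. So `F_Ψ(s)` vanishes at `x` iff `Ψ (Ts v₁, …, Ts v_d)` always lies in the
image of `T_x s` (`deformationForm_apply_eq_zero_iff`).

This image is the tangent space of `s(L)` at `s x` (`tangentVectors_range`), and `s(L)` is an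
embedded submanifold of dimension `dim L` (`isEmbeddedSubmanifold_range`); both hold because the
bundle projection is a smooth left inverse of `s`.
-/

/-! ### Derivatives and tangent vectors of maps with a smooth left inverse -/

section LeftInverse

variable {EX : Type*} [NormedAddCommGroup EX] [NormedSpace ℝ EX]
  {HX : Type*} [TopologicalSpace HX] {I : ModelWithCorners ℝ EX HX}
  {X : Type*} [TopologicalSpace X] [ChartedSpace HX X]
  {EY : Type*} [NormedAddCommGroup EY] [NormedSpace ℝ EY]
  {HY : Type*} [TopologicalSpace HY] {J : ModelWithCorners ℝ EY HY}
  {Y : Type*} [TopologicalSpace Y] [ChartedSpace HY Y]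

/-- The derivative at `q` serves as derivative at any `p = q`. The two derivatives have different
types, which agree only after `TangentSpace` is unfolded to the model space; this is used where `p`
and `q` are equal but not definitionally so, as `e + 0 • n` and `e`. -/
theorem hasMFDerivAt_mfderiv_of_eq {f : X → Y} {p q : X} (h : p = q)
    (hf : MDifferentiableAt I J f q) :
    HasMFDerivAt I J f p (mfderiv I J f q : EX →L[ℝ] EY) := by
  subst h; exact hf.hasMFDerivAt

theorem mfderiv_leftInverse_apply {f : X → Y} {r : Y → X} (hr : Function.LeftInverse r f) {x : X}
    (hf : MDifferentiableAt I J f x) (hr' : MDifferentiableAt J I r (f x)) (v : EX) :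
    (mfderiv J I r (f x) : EY →L[ℝ] EX) ((mfderiv I J f x : EX →L[ℝ] EY) v) = v := by
  have h := mfderiv_comp x hr' hf
  rw [hr.id, mfderiv_id] at h
  exact (congrArg (fun A : EX →L[ℝ] EX => A v) h).symm

theorem injective_mfderiv_of_leftInverse {f : X → Y} {r : Y → X} (hr : Function.LeftInverse r f)
    {x : X} (hf : MDifferentiableAt I J f x) (hr' : MDifferentiableAt J I r (f x)) :
    Function.Injective (mfderiv I J f x) := fun v w hvw =>
  (mfderiv_leftInverse_apply hr hf hr' v).symm.trans <|
    (congrArg (mfderiv J I r (f x) : EY →L[ℝ] EX) hvw).trans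
      (mfderiv_leftInverse_apply hr hf hr' w)

/-- A curve in a manifold with vanishing velocity is constant. -/
theorem eq_of_hasMFDerivAt_zero [IsManifold I 1 X] {c : ℝ → X}
    (hc : ∀ t, HasMFDerivAt 𝓘(ℝ, ℝ) I c t (0 : ℝ →L[ℝ] EX)) (t t' : ℝ) : c t = c t' := by
  have hcont : Continuous c := continuous_iff_continuousAt.2 fun t => (hc t).continuousAt
  have hloc : IsLocallyConstant c := by
    rw [IsLocallyConstant.iff_eventually_eq]
    intro t₀
    have hU : c ⁻¹' (chartAt HX (c t₀)).source ∈ 𝓝 t₀ :=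
      hcont.continuousAt.preimage_mem_nhds (chart_source_mem_nhds HX (c t₀))
    obtain ⟨ε, hε, hball⟩ := Metric.mem_nhds_iff.1 hU
    have hd : ∀ t ∈ Metric.ball t₀ ε,
        HasFDerivAt (extChartAt I (c t₀) ∘ c) (0 : ℝ →L[ℝ] EX) t := by
      intro t ht
      refine HasMFDerivAt.hasFDerivAt ?_
      refine (HasMFDerivAt.comp t (hasMFDerivAt_extChartAt (I := I) (hball ht))
        (hc t)).congr_mfderiv ?_
      exact ContinuousLinearMap.comp_zero _
    filter_upwards [Metric.ball_mem_nhds t₀ hε] with t ht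
    have h := Metric.isOpen_ball.is_const_of_fderiv_eq_zero (𝕜 := ℝ)
      (convex_ball t₀ ε).isPreconnected
      (fun t ht => (hd t ht).differentiableAt.differentiableWithinAt)
      (fun t ht => (hd t ht).fderiv) ht (Metric.mem_ball_self hε)
    refine (extChartAt I (c t₀)).injOn ?_ ?_ h
    · rw [extChartAt_source]; exact hball ht
    · exact mem_extChartAt_source (c t₀)
  exact hloc.apply_eq_of_isPreconnected isPreconnected_univ trivial trivial

/-- Every tangent vector is the velocity of a curve: a straight line in the chart. Without boundary
the line stays in the range of the chart for times of both signs. -/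
theorem exists_curve_mfderiv_eq [I.Boundaryless] [IsManifold I ∞ X] (x : X) (v : EX) :
    ∃ c : ℝ → X, c 0 = x ∧ ContMDiffAt 𝓘(ℝ, ℝ) I ∞ c 0 ∧
      (mfderiv 𝓘(ℝ, ℝ) I c 0 : ℝ →L[ℝ] EX) 1 = v := by
  have : IsManifold I 1 X := IsManifold.of_le (n := ∞) (by simp)
  set z := extChartAt I x x with hz
  let a : ℝ → EX := fun t => z + t • v
  have ha0 : a 0 = z := by simp [a]
  have ha : ContMDiffAt 𝓘(ℝ, ℝ) 𝓘(ℝ, EX) ∞ a 0 :=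
    (contDiff_const.add (contDiff_id.smul contDiff_const)).contMDiff 0
  have hs : ContMDiffAt 𝓘(ℝ, EX) I ∞ (extChartAt I x).symm z := by
    have := contMDiffWithinAt_extChartAt_symm_range_self (I := I) (n := ∞) x
    rwa [I.range_eq_univ, contMDiffWithinAt_univ] at this
  have hid := mfderivWithin_range_extChartAt_symm (I := I) (x := x)
  rw [I.range_eq_univ, mfderivWithin_univ] at hid
  have hd : HasDerivAt a v 0 := by
    have := ((hasDerivAt_id (0 : ℝ)).smul_const v).const_add z
    rwa [one_smul] at this
  refine ⟨fun t => (extChartAt I x).symm (a t), ?_, ?_, ?_⟩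
  · simp only [ha0]; exact extChartAt_to_inv x
  · exact ContMDiffAt.comp (0 : ℝ) (by rw [ha0]; exact hs) ha
  · have h0 := hasMFDerivAt_mfderiv_of_eq ha0 (hs.mdifferentiableAt (by simp))
    have h1 := HasMFDerivAt.comp (0 : ℝ) h0 hd.hasFDerivAt.hasMFDerivAt
    have h2 := congrArg (fun A : ℝ →L[ℝ] EX => A 1) h1.mfderiv
    refine h2.trans ?_
    rw [hid]
    exact one_smul ℝ v

/-- The tangent vectors of the image of `f` at `f x` are the image of the differential of `f` at
`x`: a curve `γ` in the image of `f` is `f ∘ (r ∘ γ)`, with `r ∘ γ` smooth. -/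
theorem tangentVectors_range [I.Boundaryless] [IsManifold I ∞ X] {f : X → Y} {r : Y → X}
    (hf : ContMDiff I J ∞ f) (hr : ContMDiff J I ∞ r) (hrf : Function.LeftInverse r f) (x : X) :
    tangentVectors J (range f) (f x) = range (mfderiv I J f x) := by
  have hfx : ∀ x, MDifferentiableAt I J f x := fun x => (hf x).mdifferentiableAt (by simp)
  ext v
  constructor
  · rintro ⟨γ, hγ, hmem, heq⟩
    have h0 : γ 0 = f x := congrArg (fun p : TangentBundle J Y => p.1) heq
    have hv : (mfderiv 𝓘(ℝ, ℝ) J γ 0 : ℝ →L[ℝ] EY) 1 = v :=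
      congrArg (fun p : TangentBundle J Y => (show EY from p.2)) heq
    have h0' : r (γ 0) = x := by rw [h0, hrf]
    have hrγ : MDifferentiableAt 𝓘(ℝ, ℝ) I (r ∘ γ) 0 :=
      ((hr (γ 0)).comp (0 : ℝ) hγ).mdifferentiableAt (by simp)
    have hfγ := hasMFDerivAt_mfderiv_of_eq h0' (hfx x)
    have h1 := HasMFDerivAt.comp (0 : ℝ) hfγ hrγ.hasMFDerivAt
    have h2 : γ =ᶠ[𝓝 0] f ∘ r ∘ γ := by
      filter_upwards [hmem] with t ht
      obtain ⟨y, hy⟩ := ht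
      simp [← hy, hrf y]
    have h3 := (h1.congr_of_eventuallyEq h2).mfderiv
    refine ⟨(mfderiv 𝓘(ℝ, ℝ) I (r ∘ γ) 0 : ℝ →L[ℝ] EX) 1, ?_⟩
    exact (congrArg (fun A : ℝ →L[ℝ] EY => A 1) h3).symm.trans hv
  · rintro ⟨w, rfl⟩
    obtain ⟨c, hc0, hc, hcw⟩ := exists_curve_mfderiv_eq (I := I) x w
    refine ⟨f ∘ c, (hf _).comp (0 : ℝ) hc, Filter.Eventually.of_forall fun t => ⟨c t, rfl⟩, ?_⟩
    have hfc := hasMFDerivAt_mfderiv_of_eq hc0 (hfx x)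
    have h1 := (HasMFDerivAt.comp (0 : ℝ) hfc
      (hc.mdifferentiableAt (by simp)).hasMFDerivAt).mfderiv
    have h2 := congrArg (fun A : ℝ →L[ℝ] EY => A 1) h1
    have aux : ∀ (p q : Y) (a b : EY), p = q → a = b →
        (⟨p, a⟩ : TangentBundle J Y) = ⟨q, b⟩ := by rintro p _ a _ rfl rfl; rfl
    refine aux _ _ _ _ (congrArg f hc0) (h2.trans ?_)
    exact congrArg (mfderiv I J f x : EX →L[ℝ] EY) hcw

end LeftInverse

/-! ### Images of smooth maps as embedded submanifolds -/

section Transport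

variable {EX : Type*} [NormedAddCommGroup EX] [NormedSpace ℝ EX]
  {H : Type*} [TopologicalSpace H] (I : ModelWithCorners ℝ EX H)
  {X : Type*} [TopologicalSpace X] [ChartedSpace H X]
  {Y : Type*} [TopologicalSpace Y]

/-- The charted space structure on `Y` transported from `X` along a homeomorphism `h : X ≃ₜ Y`:
its charts are the charts of `X` precomposed with `h⁻¹`. -/
@[reducible]
def transportChartedSpace (h : X ≃ₜ Y) : ChartedSpace H Y where
  atlas := {e | ∃ c ∈ atlas H X, e = h.symm.toOpenPartialHomeomorph.trans c}
  chartAt y := h.symm.toOpenPartialHomeomorph.trans (chartAt H (h.symm y))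
  mem_chart_source y := by simp
  chart_mem_atlas y := ⟨_, chart_mem_atlas H _, rfl⟩

theorem isManifold_transportChartedSpace [IsManifold I ∞ X] (h : X ≃ₜ Y) :
    letI := transportChartedSpace (H := H) h
    IsManifold I ∞ Y := by
  let _ := transportChartedSpace (H := H) h
  have : HasGroupoid Y (contDiffGroupoid ∞ I) := by
    constructor
    rintro _ _ ⟨c, hc, rfl⟩ ⟨c', hc', rfl⟩
    -- the homeomorphism cancels, so that the coordinate changes of `Y` are those of `X`
    have he : (h.symm.toOpenPartialHomeomorph.trans c).symm.trans
        (h.symm.toOpenPartialHomeomorph.trans c') = c.symm.trans c' := by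
      rw [OpenPartialHomeomorph.trans_symm_eq_symm_trans_symm, OpenPartialHomeomorph.trans_assoc,
        ← OpenPartialHomeomorph.trans_assoc _ _ c', ← Homeomorph.symm_toOpenPartialHomeomorph,
        ← Homeomorph.trans_toOpenPartialHomeomorph]
      simp
    rw [he]
    exact HasGroupoid.compatible hc hc'
  exact IsManifold.mk' I ∞ Y

theorem contMDiff_transport_symm [IsManifold I ∞ X] (h : X ≃ₜ Y) :
    letI := transportChartedSpace (H := H) h
    ContMDiff I I ∞ h.symm := by
  let _ := transportChartedSpace (H := H) h
  have := isManifold_transportChartedSpace I h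
  intro y
  have h1 : ContMDiffAt I I ∞ (chartAt H y) y :=
    contMDiffAt_of_mem_maximalAtlas (IsManifold.chart_mem_maximalAtlas y) (mem_chart_source H y)
  have h2 : ContMDiffAt I I ∞ (chartAt H (h.symm y)).symm (chartAt H y y) :=
    contMDiffAt_symm_of_mem_maximalAtlas (IsManifold.chart_mem_maximalAtlas _)
      (mem_chart_target H (h.symm y))
  refine (h2.comp y h1).congr_of_eventuallyEq ?_
  filter_upwards [chart_source_mem_nhds H y] with q hq
  exact ((chartAt H (h.symm y)).left_inv hq.2).symm

theorem contMDiff_transport [IsManifold I ∞ X] (h : X ≃ₜ Y) :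
    letI := transportChartedSpace (H := H) h
    ContMDiff I I ∞ h := by
  let _ := transportChartedSpace (H := H) h
  have := isManifold_transportChartedSpace I h
  intro x
  have h1 : ContMDiffAt I I ∞ (chartAt H x) x :=
    contMDiffAt_of_mem_maximalAtlas (IsManifold.chart_mem_maximalAtlas x) (mem_chart_source H x)
  have he : chartAt H (h x) = h.symm.toOpenPartialHomeomorph.trans (chartAt H x) := by
    change h.symm.toOpenPartialHomeomorph.trans (chartAt H (h.symm (h x))) = _
    rw [h.symm_apply_apply]
  have h2 : ContMDiffAt I I ∞ (chartAt H (h x)).symm (chartAt H x x) := by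
    refine contMDiffAt_symm_of_mem_maximalAtlas (IsManifold.chart_mem_maximalAtlas _) ?_
    rw [he]; simp
  refine (h2.comp x h1).congr_of_eventuallyEq ?_
  filter_upwards [chart_source_mem_nhds H x] with q hq
  rw [he]
  simp [(chartAt H x).left_inv hq]

end Transport

theorem isEmbeddedSubmanifold_range {l : ℕ} {L : Type*} [TopologicalSpace L]
    [ChartedSpace (EuclideanSpace ℝ (Fin l)) L] [IsManifold (𝓡 l) ∞ L]
    {EX : Type*} [NormedAddCommGroup EX] [NormedSpace ℝ EX]
    {HX : Type*} [TopologicalSpace HX] {I : ModelWithCorners ℝ EX HX}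
    {X : Type*} [TopologicalSpace X] [ChartedSpace HX X] {f : L → X} {r : X → L}
    (hf : ContMDiff (𝓡 l) I ∞ f) (hr : ContMDiff I (𝓡 l) ∞ r) (hrf : Function.LeftInverse r f) :
    IsEmbeddedSubmanifold I (range f) l := by
  have hemb : IsEmbedding f := hrf.isEmbedding hr.continuous hf.continuous
  let h : L ≃ₜ range f := hemb.toHomeomorph
  let _ := transportChartedSpace (H := EuclideanSpace ℝ (Fin l)) h
  have hval : (Subtype.val : range f → X) = f ∘ h.symm := by
    funext y
    exact (congrArg Subtype.val (h.apply_symm_apply y)).symm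
  have hs : ContMDiff (𝓡 l) I ∞ (Subtype.val : range f → X) := by
    rw [hval]; exact hf.comp (contMDiff_transport_symm (𝓡 l) h)
  have hr' : ContMDiff I (𝓡 l) ∞ (h ∘ r) := (contMDiff_transport (𝓡 l) h).comp hr
  refine ⟨inferInstance, isManifold_transportChartedSpace (𝓡 l) h, hs, .subtypeVal, fun p => ?_⟩
  refine injective_mfderiv_of_leftInverse (r := h ∘ r) ?_ ((hs p).mdifferentiableAt (by simp))
    ((hr' _).mdifferentiableAt (by simp))
  rintro ⟨_, x, rfl⟩
  exact Subtype.ext (congrArg f (hrf x))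

/-! ### Translation by a section -/

section FiberTranslation

variable {L : Type*} {F : Type*} {E : L → Type*} [∀ x, AddCommGroup (E x)]

variable (F) in
/-- The fibrewise translation `e ↦ e + s (π e)` of the total space by a section `s`. -/
def fiberTranslation (s : (x : L) → E x) (e : TotalSpace F E) : TotalSpace F E :=
  ⟨e.proj, e.snd + s e.proj⟩

theorem fiberTranslation_neg_leftInverse (s : (x : L) → E x) :
    Function.LeftInverse (fiberTranslation F (-s)) (fiberTranslation F s) := fun e =>
  congrArg (TotalSpace.mk e.proj) (add_neg_cancel_right e.snd (s e.proj))

theorem fiberTranslation_neg_rightInverse (s : (x : L) → E x) :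
    Function.RightInverse (fiberTranslation F (-s)) (fiberTranslation F s) := fun e =>
  congrArg (TotalSpace.mk e.proj) (neg_add_cancel_right e.snd (s e.proj))

theorem fiberTranslation_zeroSection (s : (x : L) → E x) (x : L) :
    fiberTranslation F s (zeroSection F E x) = ⟨x, s x⟩ :=
  congrArg (TotalSpace.mk x) (zero_add (s x))

end FiberTranslation

section VectorBundles

variable {EL : Type*} [NormedAddCommGroup EL] [NormedSpace ℝ EL]
  {HL : Type*} [TopologicalSpace HL] {I : ModelWithCorners ℝ EL HL}
  {L : Type*} [TopologicalSpace L] [ChartedSpace HL L]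
  {F : Type*} [NormedAddCommGroup F] [NormedSpace ℝ F]
  {E : L → Type*} [∀ x, AddCommGroup (E x)] [∀ x, Module ℝ (E x)] [∀ x, TopologicalSpace (E x)]
  [TopologicalSpace (TotalSpace F E)] [FiberBundle F E]

theorem trivialization_snd_add_smul [VectorBundle ℝ F E] {x y : L}
    (hy : y ∈ (trivializationAt F E x).baseSet) (a b : E y) (t : ℝ) :
    (trivializationAt F E x ⟨y, a + t • b⟩).2 =
      (trivializationAt F E x ⟨y, a⟩).2 + t • (trivializationAt F E x ⟨y, b⟩).2 := by
  have h (c : E y) : (trivializationAt F E x).continuousLinearMapAt ℝ y c =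
      (trivializationAt F E x ⟨y, c⟩).2 := by
    rw [Trivialization.continuousLinearMapAt_apply, Trivialization.linearMapAt_apply, if_pos hy]
  rw [← h, ← h, ← h, map_add, map_smul]

variable [VectorBundle ℝ F E] [ContMDiffVectorBundle ∞ F E I]

theorem contMDiff_fiberTranslation {s : (x : L) → E x}
    (hs : ContMDiff I (I.prod 𝓘(ℝ, F)) ∞ fun x => (⟨x, s x⟩ : TotalSpace F E)) :
    ContMDiff (I.prod 𝓘(ℝ, F)) (I.prod 𝓘(ℝ, F)) ∞ (fiberTranslation F s) := by
  intro e
  have hb := mem_baseSet_trivializationAt F E e.proj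
  rw [Trivialization.contMDiffAt_iff (e := trivializationAt F E e.proj)
    (by rw [Trivialization.mem_source]; exact hb)]
  have hπ : ContMDiffAt (I.prod 𝓘(ℝ, F)) I ∞ (TotalSpace.proj : TotalSpace F E → L) e :=
    contMDiffAt_proj E
  refine ⟨hπ, ?_⟩
  have h1 := ((Trivialization.contMDiffAt_iff (e := trivializationAt F E e.proj)
    ((Trivialization.mem_source _).2 hb)).1 (contMDiffAt_id (I := I.prod 𝓘(ℝ, F)) (n := ∞)
      (x := e))).2
  have h2 := ((Trivialization.contMDiffAt_section_iff (trivializationAt F E e.proj) hb).1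
    (hs e.proj)).comp e hπ
  refine (h1.add h2).congr_of_eventuallyEq ?_
  filter_upwards [(FiberBundle.continuous_proj F E).continuousAt.preimage_mem_nhds
    ((trivializationAt F E e.proj).open_baseSet.mem_nhds hb)] with q hq
  have := trivialization_snd_add_smul (F := F) hq q.snd (s q.proj) 1
  simpa [fiberTranslation] using this

theorem isInvertible_mfderiv_fiberTranslation {s : (x : L) → E x}
    (hs : ContMDiff I (I.prod 𝓘(ℝ, F)) ∞ fun x => (⟨x, s x⟩ : TotalSpace F E))
    (e : TotalSpace F E) :
    (mfderiv (I.prod 𝓘(ℝ, F)) (I.prod 𝓘(ℝ, F)) (fiberTranslation F s) e).IsInvertible := by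
  have h1 (p) := (contMDiff_fiberTranslation hs p).mdifferentiableAt (by simp)
  have h2 (p) := (contMDiff_fiberTranslation (ContMDiff.neg_section hs) p).mdifferentiableAt
    (by simp)
  refine ContinuousLinearMap.IsInvertible.of_inverse (g := (mfderiv (I.prod 𝓘(ℝ, F))
    (I.prod 𝓘(ℝ, F)) (fiberTranslation F (-s)) (fiberTranslation F s e) :
      (EL × F) →L[ℝ] (EL × F))) ?_ ?_
  · have h3 := hasMFDerivAt_mfderiv_of_eq (fiberTranslation_neg_leftInverse s e) (h1 e)
    have h4 := HasMFDerivAt.comp _ h3 (h2 _).hasMFDerivAt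
    rw [(fiberTranslation_neg_rightInverse s).id] at h4
    exact h4.mfderiv.symm.trans mfderiv_id
  · ext1 v
    exact mfderiv_leftInverse_apply (fiberTranslation_neg_leftInverse s) (h1 e) (h2 _) v

/-! ### The flow of the vertical vector field of a section -/

theorem mfderiv_verticalLift_apply {EN : Type*} [NormedAddCommGroup EN] [NormedSpace ℝ EN]
    {HN : Type*} [TopologicalSpace HN] {J : ModelWithCorners ℝ EN HN}
    {N : Type*} [TopologicalSpace N] [ChartedSpace HN N] {g : TotalSpace F E → N}
    {e : TotalSpace F E} (hg : MDifferentiableAt (I.prod 𝓘(ℝ, F)) J g e) (n : E e.proj) :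
    (mfderiv (I.prod 𝓘(ℝ, F)) J g e : (EL × F) →L[ℝ] EN) (verticalLift I F E e n) =
      (mfderiv 𝓘(ℝ, ℝ) J (fun t : ℝ => g ⟨e.proj, e.snd + t • n⟩) 0 : ℝ →L[ℝ] EN) 1 := by
  have h0 : (⟨e.proj, e.snd + (0 : ℝ) • n⟩ : TotalSpace F E) = e := by simp
  have h1 := hasMFDerivAt_mfderiv_of_eq h0 hg
  have h2 := HasMFDerivAt.comp (0 : ℝ) h1
    (((contMDiff_verticalCurve I F E e n) 0).mdifferentiableAt (by simp)).hasMFDerivAt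
  exact (congrArg (fun A : ℝ →L[ℝ] EN => A 1) h2.mfderiv).symm

theorem mfderiv_proj_verticalLift (e : TotalSpace F E) (n : E e.proj) :
    (mfderiv (I.prod 𝓘(ℝ, F)) I (TotalSpace.proj : TotalSpace F E → L) e : (EL × F) →L[ℝ] EL)
      (verticalLift I F E e n) = 0 := by
  have hπ : ContMDiffAt (I.prod 𝓘(ℝ, F)) I ∞ (TotalSpace.proj : TotalSpace F E → L) e :=
    contMDiffAt_proj E
  rw [mfderiv_verticalLift_apply (hπ.mdifferentiableAt (by simp)) n]
  exact congrArg (fun A : ℝ →L[ℝ] EL => A 1) (mfderiv_const (I := 𝓘(ℝ, ℝ)) (c := e.proj))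

theorem mfderiv_trivialization_snd_verticalLift {x : L} {e : TotalSpace F E} (he : e.proj = x)
    (n : E e.proj) :
    (mfderiv (I.prod 𝓘(ℝ, F)) 𝓘(ℝ, F) (fun e : TotalSpace F E => (trivializationAt F E x e).2) e :
      (EL × F) →L[ℝ] F) (verticalLift I F E e n) = (trivializationAt F E x ⟨e.proj, n⟩).2 := by
  rw [mfderiv_verticalLift_apply (mdifferentiableAt_trivialization_snd I F E x e he) n]
  have hb : e.proj ∈ (trivializationAt F E x).baseSet :=
    he ▸ mem_baseSet_trivializationAt F E e.proj
  have hc : (fun t : ℝ => (trivializationAt F E x ⟨e.proj, e.snd + t • n⟩).2) =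
      fun t : ℝ => (trivializationAt F E x ⟨e.proj, e.snd⟩).2 +
        t • (trivializationAt F E x ⟨e.proj, n⟩).2 :=
    funext (trivialization_snd_add_smul hb e.snd n)
  have hd := (((hasDerivAt_id (0 : ℝ)).smul_const
    (trivializationAt F E x ⟨e.proj, n⟩).2).const_add (trivializationAt F E x ⟨e.proj, e.snd⟩).2)
  rw [one_smul] at hd
  refine (congrArg (fun A : ℝ →L[ℝ] F => A 1)
    (hd.hasFDerivAt.hasMFDerivAt.congr_of_eventuallyEq hc.eventuallyEq).mfderiv).trans ?_
  exact one_smul ℝ _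

/-- Integral curves of `ι_L(s)` are the affine lines `t ↦ e + t s(π e)`: as `ι_L(s)` is vertical, an
integral curve stays in one fibre, and there its velocity is the constant `s(π e)`. -/
theorem IsMIntegralCurve.eq_add_smul [IsManifold I 1 L] {s : (x : L) → E x} {γ : ℝ → TotalSpace F E}
    (hγ : IsMIntegralCurve (I := I.prod 𝓘(ℝ, F)) γ (iotaField I F E s)) (t : ℝ) :
    γ t = ⟨(γ 0).proj, (γ 0).snd + t • s (γ 0).proj⟩ := by
  have hproj : ∀ t, (γ t).proj = (γ 0).proj := by
    refine fun t => eq_of_hasMFDerivAt_zero (I := I) (c := fun t => (γ t).proj) (fun t => ?_) t 0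
    have hπ : ContMDiffAt (I.prod 𝓘(ℝ, F)) I ∞ (TotalSpace.proj : TotalSpace F E → L) (γ t) :=
      contMDiffAt_proj E
    refine (HasMFDerivAt.comp t (hπ.mdifferentiableAt (by simp)).hasMFDerivAt
      (hγ t)).congr_mfderiv ?_
    ext
    refine (congrArg _ (one_smul ℝ _)).trans ?_
    exact mfderiv_proj_verticalLift (I := I) (γ t) (s (γ t).proj)
  set x := (γ 0).proj with hx
  set T := trivializationAt F E x with hT
  have hb : x ∈ T.baseSet := mem_baseSet_trivializationAt F E x
  have hs : ∀ y, y = x → (T ⟨y, s y⟩).2 = (T ⟨x, s x⟩).2 := by rintro _ rfl; rfl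
  have hu : ∀ t, HasFDerivAt (fun t => (T (γ t)).2)
      ((1 : ℝ →L[ℝ] ℝ).smulRight (T ⟨x, s x⟩).2) t := by
    intro t
    refine HasMFDerivAt.hasFDerivAt ?_
    refine (HasMFDerivAt.comp t (mdifferentiableAt_trivialization_snd I F E x (γ t)
      (hproj t)).hasMFDerivAt (hγ t)).congr_mfderiv ?_
    ext
    refine (congrArg _ (one_smul ℝ _)).trans ?_
    refine (mfderiv_trivialization_snd_verticalLift (I := I) (hproj t) (s (γ t).proj)).trans ?_
    rw [hs _ (hproj t)]
    exact (one_smul ℝ _).symm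
  have hv : ∀ t, HasFDerivAt (fun t : ℝ => (T ⟨x, (γ 0).snd⟩).2 + t • (T ⟨x, s x⟩).2)
      ((1 : ℝ →L[ℝ] ℝ).smulRight (T ⟨x, s x⟩).2) t := by
    intro t
    have := (((hasDerivAt_id t).smul_const (T ⟨x, s x⟩).2).const_add (T ⟨x, (γ 0).snd⟩).2)
    rw [one_smul] at this
    exact this.hasFDerivAt
  have huv := congrFun <| eq_of_fderiv_eq (𝕜 := ℝ) (fun t => (hu t).differentiableAt)
    (fun t => (hv t).differentiableAt) (fun t => (hu t).fderiv.trans (hv t).fderiv.symm) 0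
    (by simp only [zero_smul, add_zero]; rfl)
  refine T.injOn ?_ ?_ (Prod.ext ?_ ?_)
  · rw [T.mem_source, hproj t]; exact hb
  · rw [T.mem_source]; exact hb
  · exact (T.coe_fst' ((hproj t).symm ▸ hb)).trans
      ((hproj t).trans (T.coe_fst' (x := ⟨x, (γ 0).snd + t • s x⟩) hb).symm)
  · exact (huv t).trans (trivialization_snd_add_smul hb _ _ t).symm

/-- `exp ι_L(s)` is the translation by `s`. -/
theorem expField_iotaField [IsManifold I 1 L] (s : (x : L) → E x) :
    expField (I.prod 𝓘(ℝ, F)) (iotaField I F E s) = fiberTranslation F s := by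
  funext e
  have h : ∃ γ : ℝ → TotalSpace F E, γ 0 = e ∧
      IsMIntegralCurve (I := I.prod 𝓘(ℝ, F)) γ (iotaField I F E s) :=
    ⟨_, by simp, isMIntegralCurve_iotaField I F E s e⟩
  rw [expField, dif_pos h, h.choose_spec.2.eq_add_smul 1, h.choose_spec.1, one_smul]
  rfl

/-! ### The deformation form -/

/-- The kernel of `P_L` at `0_x` is the tangent space of the zero section. -/
theorem normalProj_eq_zero_iff (x : L) (w : EL × F) :
    normalProj I F E x w = 0 ↔
      ∃ u : EL, (mfderiv I (I.prod 𝓘(ℝ, F)) (zeroSection F E) x : EL →L[ℝ] (EL × F)) u = w := by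
  constructor
  · intro h
    set T := trivializationAt F E x with hT
    have hb : x ∈ T.baseSet := mem_baseSet_trivializationAt F E x
    set z : TotalSpace F E := zeroSection F E x
    have hz : z ∈ T.source := T.mem_source.2 hb
    let D0 : EL →L[ℝ] (EL × F) := mfderiv I (I.prod 𝓘(ℝ, F)) (zeroSection F E) x
    let P : (EL × F) →L[ℝ] EL := mfderiv (I.prod 𝓘(ℝ, F)) I (TotalSpace.proj : TotalSpace F E → L) z
    let Q : (EL × F) →L[ℝ] F :=
      mfderiv (I.prod 𝓘(ℝ, F)) 𝓘(ℝ, F) (fun e : TotalSpace F E => (T e).2) z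
    have hker : ∀ w, normalProj I F E x w = 0 → Q w = 0 := by
      intro w hw
      have := congrArg (T.continuousLinearMapAt ℝ x) hw
      rw [map_zero] at this
      exact (T.continuousLinearMapAt_symmL hb (Q w)).symm.trans this
    have hπ : ContMDiffAt (I.prod 𝓘(ℝ, F)) I ∞ (TotalSpace.proj : TotalSpace F E → L) z :=
      contMDiffAt_proj E
    have hπ' := hπ.mdifferentiableAt (by simp)
    -- in the trivialization, `T_z E = T_x L ⊕ F` by the pair of the differentials `P` and `Q`
    have hPQ : mfderiv (I.prod 𝓘(ℝ, F)) (I.prod 𝓘(ℝ, F)) T z = P.prod Q := by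
      have h1 := (hπ'.hasMFDerivAt.prodMk
        (mdifferentiableAt_trivialization_snd I F E x z rfl).hasMFDerivAt)
      refine (h1.congr_of_eventuallyEq ?_).mfderiv
      filter_upwards [T.open_source.mem_nhds hz] with q hq
      exact (T.mk_proj_snd hq).symm
    have hT' : T.toOpenPartialHomeomorph.MDifferentiable (I.prod 𝓘(ℝ, F)) (I.prod 𝓘(ℝ, F)) :=
      ⟨(T.contMDiffOn (n := ∞) (IB := I)).mdifferentiableOn (by simp),
        (T.contMDiffOn_symm (n := ∞) (IB := I)).mdifferentiableOn (by simp)⟩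
    have hinj : Function.Injective (P.prod Q) := by
      have := hT'.mfderiv_injective hz
      erw [hPQ] at this
      exact this
    have hz0 : MDifferentiableAt I (I.prod 𝓘(ℝ, F)) (zeroSection F E) x :=
      ((contMDiff_zeroSection ℝ E (n := ∞) (IB := I)) x).mdifferentiableAt (by simp)
    refine ⟨P w, hinj (Prod.ext ?_ ?_)⟩
    · exact mfderiv_leftInverse_apply (r := (TotalSpace.proj : TotalSpace F E → L))
        (fun _ => rfl) hz0 hπ' (P w)
    · exact (hker _ (normalProj_zeroSection I F E x (P w))).trans (hker w h).symm
  · rintro ⟨u, rfl⟩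
    exact normalProj_zeroSection I F E x u

/-- `F_Ψ(s)` vanishes on `v` iff `Ψ` at `s x` sends the images of `v` under the differential of `s`
to a vector tangent to the image of `s`. -/
theorem deformationForm_apply_eq_zero_iff [IsManifold I 1 L] {d : ℕ}
    (Ψ : TangentForm (I.prod 𝓘(ℝ, F)) (TotalSpace F E) d) {s : (x : L) → E x}
    (hs : ContMDiff I (I.prod 𝓘(ℝ, F)) ∞ fun x => (⟨x, s x⟩ : TotalSpace F E))
    (x : L) (v : Fin d → EL) :
    deformationForm I F E Ψ s x v = 0 ↔
      Ψ ⟨x, s x⟩ (fun i => mfderiv I (I.prod 𝓘(ℝ, F))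
        (fun x => (⟨x, s x⟩ : TotalSpace F E)) x (v i)) ∈
      range (mfderiv I (I.prod 𝓘(ℝ, F)) (fun x => (⟨x, s x⟩ : TotalSpace F E)) x) := by
  let D0 : EL →L[ℝ] (EL × F) := mfderiv I (I.prod 𝓘(ℝ, F)) (zeroSection F E) x
  let DS : EL →L[ℝ] (EL × F) :=
    mfderiv I (I.prod 𝓘(ℝ, F)) (fun x => (⟨x, s x⟩ : TotalSpace F E)) x
  let A : (EL × F) →L[ℝ] (EL × F) :=
    mfderiv (I.prod 𝓘(ℝ, F)) (I.prod 𝓘(ℝ, F)) (fiberTranslation F s) (zeroSection F E x)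
  have hA : A.IsInvertible := isInvertible_mfderiv_fiberTranslation hs _
  -- chain rule for the translation by `s` composed with the zero section, which is `s`
  have hDS : ∀ u, A (D0 u) = DS u := by
    intro u
    have hz : MDifferentiableAt I (I.prod 𝓘(ℝ, F)) (zeroSection F E) x :=
      ((contMDiff_zeroSection ℝ E (n := ∞) (IB := I)) x).mdifferentiableAt (by simp)
    have h := mfderiv_comp x ((contMDiff_fiberTranslation hs _).mdifferentiableAt (by simp)) hz
    have hc : fiberTranslation F s ∘ zeroSection F E = fun x => (⟨x, s x⟩ : TotalSpace F E) :=
      funext (fiberTranslation_zeroSection s)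
    have h' : DS = A.comp D0 := by
      refine Eq.trans ?_ h
      simp only [DS]
      rw [hc]
    rw [h']; rfl
  have hΨ : ∀ p q : TotalSpace F E, p = q → ∀ w : Fin d → EL × F,
      (Ψ p w : EL × F) = Ψ q w := by rintro p _ rfl w; rfl
  let k : EL × F := Ψ ⟨x, s x⟩ fun i => DS (v i)
  have hval : deformationForm I F E Ψ s x v = normalProj I F E x (A.inverse k) := by
    have h1 : deformationForm I F E Ψ s x v = normalProj I F E x (A.inverse
        (Ψ (fiberTranslation F s (zeroSection F E x)) fun i => A (D0 (v i)))) := by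
      simp only [deformationForm, expField_iotaField]
      rfl
    rw [h1]
    simp only [hDS]
    exact congrArg (fun k => normalProj I F E x (A.inverse k))
      (hΨ _ _ (fiberTranslation_zeroSection s x) _)
  rw [hval, normalProj_eq_zero_iff]
  change (∃ u, D0 u = A.inverse k) ↔ ∃ u, DS u = k
  refine exists_congr fun u => ?_
  rw [eq_comm, hA.inverse_apply_eq, hDS, eq_comm]

end VectorBundles

/-- The equivalence for an arbitrary smooth vector bundle `E → L` and an arbitrary (not necessarily
smooth) form `Ψ` on its total space. -/
theorem isPsiSection_iff_deformationForm_eq_zero {l d : ℕ} {L : Type*} [TopologicalSpace L]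
    [ChartedSpace (EuclideanSpace ℝ (Fin l)) L] [IsManifold (𝓡 l) ∞ L]
    {F : Type*} [NormedAddCommGroup F] [NormedSpace ℝ F]
    {E : L → Type*} [∀ x, AddCommGroup (E x)] [∀ x, Module ℝ (E x)] [∀ x, TopologicalSpace (E x)]
    [TopologicalSpace (TotalSpace F E)] [FiberBundle F E] [VectorBundle ℝ F E]
    [ContMDiffVectorBundle ∞ F E (𝓡 l)]
    (Ψ : TangentForm ((𝓡 l).prod 𝓘(ℝ, F)) (TotalSpace F E) d) (hd : d ≤ l)
    {s : (x : L) → E x}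
    (hs : ContMDiff (𝓡 l) ((𝓡 l).prod 𝓘(ℝ, F)) ∞ fun x => (⟨x, s x⟩ : TotalSpace F E)) :
    IsPsiSection (𝓡 l) F E Ψ s ↔ ∀ x, deformationForm (𝓡 l) F E Ψ s x = 0 := by
  have : IsManifold (𝓡 l) 1 L := IsManifold.of_le (n := ∞) (by simp)
  have hπ : ContMDiff ((𝓡 l).prod 𝓘(ℝ, F)) (𝓡 l) ∞ (TotalSpace.proj : TotalSpace F E → L) :=
    contMDiff_proj E
  have hinv : Function.LeftInverse (TotalSpace.proj : TotalSpace F E → L)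
    fun x => (⟨x, s x⟩ : TotalSpace F E) := fun _ => rfl
  have htan := tangentVectors_range hs hπ hinv
  constructor
  · rintro ⟨-, h⟩ x
    ext v
    refine (deformationForm_apply_eq_zero_iff Ψ hs x v).2 ?_
    rw [← htan x]
    refine h _ ⟨x, rfl⟩ _ fun i => ?_
    erw [htan x]
    exact ⟨v i, rfl⟩
  · refine fun h => ⟨⟨l, hd, isEmbeddedSubmanifold_range hs hπ hinv⟩, ?_⟩
    rintro _ ⟨x, rfl⟩ v hv
    simp only [htan x] at hv ⊢
    choose u hu using hv
    obtain rfl : (fun i => mfderiv (𝓡 l) ((𝓡 l).prod 𝓘(ℝ, F))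
      (fun x => (⟨x, s x⟩ : TotalSpace F E)) x (u i)) = v := funext hu
    exact (deformationForm_apply_eq_zero_iff Ψ hs x u).1 (by rw [h x]; rfl)

theorem proposition5p2 {l m d : ℕ}
    {M : Type*} [TopologicalSpace M] [T2Space M] [SecondCountableTopology M]
    [ChartedSpace (EuclideanSpace ℝ (Fin m)) M] [IsManifold (𝓡 m) ∞ M]
    {L : Type*} [TopologicalSpace L]
    [ChartedSpace (EuclideanSpace ℝ (Fin l)) L] [IsManifold (𝓡 l) ∞ L]
    (j : L → M) (hj : IsEmbeddingOfManifolds (𝓡 l) (𝓡 m) j)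
    {F : Type*} [NormedAddCommGroup F] [NormedSpace ℝ F] [FiniteDimensional ℝ F]
    [TopologicalSpace (TotalSpace F (NormalFiber (𝓡 l) (𝓡 m) j))]
    [FiberBundle F (NormalFiber (𝓡 l) (𝓡 m) j)]
    [VectorBundle ℝ F (NormalFiber (𝓡 l) (𝓡 m) j)]
    [ContMDiffVectorBundle ∞ F (NormalFiber (𝓡 l) (𝓡 m) j) (𝓡 l)]
    (hN : IsNormalBundle (𝓡 l) (𝓡 m) j F)
    (τ : TotalSpace F (NormalFiber (𝓡 l) (𝓡 m) j) → M)
    (hτ : IsTubularNeighborhood (𝓡 l) (𝓡 m) j F (NormalFiber (𝓡 l) (𝓡 m) j) τ)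
    (Ψ : TangentForm (𝓡 m) M d) (hΨ : IsSmoothForm (𝓡 m) Ψ) (hd : d ≤ l)
    (s : Cₛ^∞⟮𝓡 l; F, NormalFiber (𝓡 l) (𝓡 m) j⟯) :
    IsPsiSection (𝓡 l) F (NormalFiber (𝓡 l) (𝓡 m) j)
        (pullbackForm ((𝓡 l).prod 𝓘(ℝ, F)) (𝓡 m) τ Ψ) s ↔
      ∀ x : L, deformationForm (𝓡 l) F (NormalFiber (𝓡 l) (𝓡 m) j)
        (pullbackForm ((𝓡 l).prod 𝓘(ℝ, F)) (𝓡 m) τ Ψ) s x = 0 :=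
  isPsiSection_iff_deformationForm_eq_zero _ hd s.contMDiff
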